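/- Let $k$ be a field, $R=k[x,y,z]$ with its standard grading, and $m=(x,y,z)$. Call proper homogeneous ideals $I,J\subset R$ with $R/I$ and $R/J$ Cohen–Macaulay *homogeneously G-linked* if there is a homogeneous ideal $G$ such that $R/G$ is a Gorenstein ring, $G:_R I=J$ and $G:_R J=I$. Let $I$ be an $m$-primary monomial ideal of $R$ whose minimal number of generators satisfies $\mu(I)\le 6$. Then $I$ is homogeneously glicci via a sequence of G-links with an $m$-primary monomial ideal at each second step. That is, there are an integer $l\ge 0$ and ideals $I=J_0,J_1,\dots,J_l$ of $R$ such that $J_i$ and $J_{i+1}$ are homogeneously G-linked for every $0\le i<l$, the ideal $J_l$ is a homogeneous complete intersection ideal (an ideal generated by a regular sequence), and $J_i$ is an $m$-primary monomial ideal for every even $i$ with $0\le i\le l$. -/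

import Mathlib

namespace Glicci

universe u

/-- A Noetherian ring is Cohen-Macaulay if every localization `A_p` at a maximal ideal contains,
inside its maximal ideal, a regular sequence whose length is the Krull dimension of `A_p`. -/
def IsCohenMacaulayRing (A : Type u) [CommRing A] : Prop :=
  IsNoetherianRing A ∧
    ∀ (p : Ideal A) [p.IsMaximal], ∃ rs : List (Localization.AtPrime p),
      (∀ r ∈ rs, r ∈ IsLocalRing.maximalIdeal (Localization.AtPrime p)) ∧
      RingTheory.Sequence.IsRegular (Localization.AtPrime p) rs ∧
      (rs.length : WithBot ℕ∞) = ringKrullDim (Localization.AtPrime p)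

/-- A Noetherian ring is Gorenstein if every localization at a maximal ideal has finite injective
dimension as a module over itself. -/
def IsGorensteinRing (A : Type u) [CommRing A] : Prop :=
  IsNoetherianRing A ∧
    ∀ (p : Ideal A) [p.IsMaximal], ∃ d : ℕ,
      CategoryTheory.HasInjectiveDimensionLE
        (ModuleCat.of (Localization.AtPrime p) (Localization.AtPrime p)) d

/-- A complete intersection ideal: an ideal generated by a regular sequence. -/
def IsCompleteIntersectionIdeal {R : Type u} [CommRing R] (C : Ideal R) : Prop :=
  ∃ rs : List R, RingTheory.Sequence.IsRegular R rs ∧ C = Ideal.ofList rs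

variable {k : Type u} [Field k] {n : ℕ}

/-- Homogeneity for the standard grading of `k[x₁, …, xₙ]`. -/
def IsHomogeneousIdeal (I : Ideal (MvPolynomial (Fin n) k)) : Prop :=
  letI : GradedAlgebra (MvPolynomial.homogeneousSubmodule (Fin n) k) := MvPolynomial.gradedAlgebra
  Ideal.IsHomogeneous (MvPolynomial.homogeneousSubmodule (Fin n) k) I

/-- An ideal generated by monomials. -/
def IsMonomialIdeal (I : Ideal (MvPolynomial (Fin n) k)) : Prop :=
  ∃ S : Set (Fin n →₀ ℕ), I = Ideal.span ((fun a => MvPolynomial.monomial a (1 : k)) '' S)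

/-- The homogeneous maximal ideal `m = (x₁, …, xₙ)`. -/
noncomputable def irrelevantIdeal (k : Type u) [Field k] (n : ℕ) : Ideal (MvPolynomial (Fin n) k) :=
  Ideal.span (Set.range MvPolynomial.X)

/-- `I` is `m`-primary: a primary ideal with radical `m`. -/
def IsMPrimary (I : Ideal (MvPolynomial (Fin n) k)) : Prop :=
  I.IsPrimary ∧ I.radical = irrelevantIdeal k n

/-- The ideals `I` and `J` are homogeneously G-linked by `G`, written `I ~_G J`: `I` and `J` are
proper, homogeneous and Cohen-Macaulay, `G` is homogeneous and Gorenstein, and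
`G : I = J`, `G : J = I`. -/
structure IsHomogeneousGLinkBy (G I J : Ideal (MvPolynomial (Fin n) k)) : Prop where
  left_ne_top : I ≠ ⊤
  right_ne_top : J ≠ ⊤
  left_homogeneous : IsHomogeneousIdeal I
  right_homogeneous : IsHomogeneousIdeal J
  left_cohenMacaulay : IsCohenMacaulayRing (MvPolynomial (Fin n) k ⧸ I)
  right_cohenMacaulay : IsCohenMacaulayRing (MvPolynomial (Fin n) k ⧸ J)
  homogeneous : IsHomogeneousIdeal G
  gorenstein : IsGorensteinRing (MvPolynomial (Fin n) k ⧸ G)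
  colon_left : G.colon (I : Set (MvPolynomial (Fin n) k)) = J
  colon_right : G.colon (J : Set (MvPolynomial (Fin n) k)) = I

/-- `J 0 ~ J 1 ~ ⋯ ~ J l` is a sequence of homogeneous G-links from `I` to a homogeneous complete
intersection ideal (the values `J i` with `i > l` play no role). An ideal for which such a
sequence exists is homogeneously glicci. -/
structure IsHomogeneousGlicciSequence (I : Ideal (MvPolynomial (Fin n) k)) (l : ℕ)
    (J : ℕ → Ideal (MvPolynomial (Fin n) k)) : Prop where
  start : J 0 = I
  link : ∀ i < l, ∃ G, IsHomogeneousGLinkBy G (J i) (J (i + 1))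
  finish_homogeneous : IsHomogeneousIdeal (J l)
  finish_completeIntersection : IsCompleteIntersectionIdeal (J l)

end Glicci

/-! An `m`-primary monomial ideal with `μ ≤ 6` has three pure-power generators and at most three
others: it is a box ideal `(x_i ^ (T i + 1))` plus the monomials of a set `K` with `|K| ≤ 3`
(`exists_eq_boxSum`).

The links come from Macaulay duality. Summing the coefficients at exponents of one fixed degree is a
functional, and the largest ideal in its kernel is homogeneous and Gorenstein. A single exponent `T`
gives the box complete intersection, which links a box plus `K` to a colon ideal
(`linked_boxSum_boxColon`). Suitable sets of exponents, one for each variable, link two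
intersections of box ideals whose corners `P i` and `Q i` agree except in coordinate `i`
(`linked_boxInter_boxInter`).

The proof is an induction on the bound for `|K|` and on the degree of `T`. A generator outside the
box is redundant, a pure power shrinks the box, and a variable common to all of `K` is divided out
by two links. If none of this applies and `K` is nonempty, then `K` consists of three monomials, the
`i`-th involving exactly the variables other than `x_i`. Its colon ideal is an intersection of three
boxes. Replacing the diagonal of the corners by the smallest one that the second kind of link
allows, and linking back, either gives a complete intersection or turns a generator into a pure
power (`monomiallyGlicci_of_no_common`). All ideals of the chain are monomial; only the linking
Gorenstein ideals need not be. -/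

namespace Glicci

open MvPolynomial

universe u

/-! ### Self-injective and Artinian rings -/

section Frobenius

variable {k : Type*} [Field k] {A : Type u} [CommRing A] [Algebra k A]

/-- A finite-dimensional algebra with a functional whose kernel contains no nonzero ideal is
self-injective. -/
theorem baer_of_functional [Module.Finite k A] (φ : A →ₗ[k] k)
    (hφ : ∀ a : A, (∀ b, φ (a * b) = 0) → a = 0) : Module.Baer A A := by
  let Φ : A →ₗ[k] Module.Dual k A :=
    { toFun := fun a => φ ∘ₗ LinearMap.mulLeft k a
      map_add' := fun a b => by ext c; simp [add_mul]
      map_smul' := fun a b => by ext c; simp }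
  have hΦ : Function.Injective Φ := by
    rw [← LinearMap.ker_eq_bot, LinearMap.ker_eq_bot']
    intro a ha
    exact hφ a fun b => LinearMap.congr_fun ha b
  -- By equality of dimensions every functional on `A` is `φ (a * ·)`; applied to an extension of `φ
  -- ∘ f`, this yields the multiplier that extends `f`.
  have hsurj : Function.Surjective Φ :=
    (LinearMap.injective_iff_surjective_of_finrank_eq_finrank
      (Subspace.dual_finrank_eq (K := k) (V := A)).symm).1 hΦ
  intro I f
  obtain ⟨ψ, hψ⟩ := LinearMap.exists_extend
    (p := I.restrictScalars k) (φ ∘ₗ (f.restrictScalars k))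
  obtain ⟨a, ha⟩ := hsurj ψ
  refine ⟨LinearMap.mulLeft A a, fun x hx => ?_⟩
  have key : ∀ y (hy : y ∈ I), φ (a * y) = φ (f ⟨y, hy⟩) := fun y hy => by
    have h1 := LinearMap.congr_fun hψ ⟨y, hy⟩
    have h2 := LinearMap.congr_fun ha y
    exact h2.trans h1
  refine sub_eq_zero.1 (hφ _ fun b => ?_)
  have hb : b * x ∈ I := I.mul_mem_left b hx
  have h3 : f ⟨b * x, hb⟩ = b * f ⟨x, hx⟩ := by
    rw [← smul_eq_mul b (f _), ← f.map_smul]; rfl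
  have := key (b * x) hb
  rw [h3] at this
  simp only [LinearMap.mulLeft_apply, sub_mul, map_sub]
  rw [mul_comm (f ⟨x, hx⟩) b, ← this, mul_assoc, mul_comm x b, sub_self]

/-- Over a Noetherian ring injectivity passes to localizations, so the injective dimension is zero
everywhere. -/
theorem isGorensteinRing_of_baer [IsNoetherianRing A] (h : Module.Baer A A) :
    IsGorensteinRing A := by
  refine ⟨inferInstance, fun p _ => ⟨0, ?_⟩⟩
  have : Module.Injective A A := Module.Baer.injective h
  have : Module.Injective (Localization.AtPrime p) (Localization.AtPrime p) :=
    Module.injective_of_isLocalizedModule p.primeCompl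
      (Algebra.linearMap A (Localization.AtPrime p))
  have := Module.injective_object_of_injective_module (Localization.AtPrime p)
    (Localization.AtPrime p)
  simpa [CategoryTheory.HasInjectiveDimensionLE,
    ← CategoryTheory.injective_iff_hasInjectiveDimensionLT_one] using this

theorem isCohenMacaulayRing_of_isArtinianRing [IsArtinianRing A] : IsCohenMacaulayRing A := by
  refine ⟨inferInstance, fun p _ => ⟨[], by simp, RingTheory.Sequence.IsRegular.nil _ _, ?_⟩⟩
  have : IsArtinianRing (Localization.AtPrime p) :=
    IsArtinianRing.localization_artinian p.primeCompl _
  have := (isArtinianRing_iff_isNoetherianRing_krullDimLE_zero.1 this).2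
  rw [ringKrullDimZero_iff_ringKrullDim_eq_zero.1 this]
  rfl

end Frobenius

/-! ### Gorenstein ideals from functionals -/

section AnnihilatorIdeal

variable {k : Type*} [Field k] {A : Type u} [CommRing A] [Algebra k A]

/-- The largest ideal contained in the kernel of a functional. -/
def annihilatorIdeal (φ : A →ₗ[k] k) : Ideal A where
  carrier := {r | ∀ s, φ (r * s) = 0}
  add_mem' ha hb s := by rw [add_mul, map_add, ha s, hb s, add_zero]
  zero_mem' s := by simp
  smul_mem' c r hr s := by
    rw [smul_eq_mul, mul_comm c, mul_assoc]
    exact hr _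

theorem mem_annihilatorIdeal {φ : A →ₗ[k] k} {r : A} :
    r ∈ annihilatorIdeal φ ↔ ∀ s, φ (r * s) = 0 := Iff.rfl

/-- The functional descends to the quotient, where its kernel contains no nonzero ideal. -/
theorem isGorensteinRing_quotient_annihilatorIdeal (φ : A →ₗ[k] k)
    [Module.Finite k (A ⧸ annihilatorIdeal φ)] : IsGorensteinRing (A ⧸ annihilatorIdeal φ) := by
  have : IsNoetherianRing (A ⧸ annihilatorIdeal φ) := IsNoetherianRing.of_finite k _
  let ψ : (A ⧸ annihilatorIdeal φ) →ₗ[k] k :=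
    ((annihilatorIdeal φ).restrictScalars k).liftQ φ fun r hr => by
      simpa using mem_annihilatorIdeal.1 hr 1
  refine isGorensteinRing_of_baer (baer_of_functional ψ fun a ha => ?_)
  obtain ⟨r, rfl⟩ := Ideal.Quotient.mk_surjective a
  exact Ideal.Quotient.eq_zero_iff_mem.2 fun s => ha (Ideal.Quotient.mk _ s)

end AnnihilatorIdeal

/-! ### Monomial ideals as upper sets of exponents -/

section Monomial

variable {k : Type u} [Field k] {n : ℕ}

theorem finite_quotient_of_finite_compl (I : Ideal (MvPolynomial (Fin n) k))
    (U : Set (Fin n →₀ ℕ)) (hU : Uᶜ.Finite) (h : ∀ v ∈ U, monomial v (1 : k) ∈ I) :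
    Module.Finite k (MvPolynomial (Fin n) k ⧸ I) := by
  refine ⟨Submodule.fg_def.2
    ⟨(fun v => Ideal.Quotient.mk I (monomial v (1 : k))) '' Uᶜ, hU.image _, ?_⟩⟩
  refine eq_top_iff.2 fun a _ => ?_
  obtain ⟨r, rfl⟩ := Ideal.Quotient.mk_surjective a
  induction r using MvPolynomial.induction_on' with
  | monomial v c =>
    have : Ideal.Quotient.mk I (monomial v c) = c • Ideal.Quotient.mk I (monomial v (1 : k)) := by
      rw [← Ideal.Quotient.mkₐ_eq_mk k, ← map_smul, smul_monomial, smul_eq_mul, mul_one]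
    rw [this]
    refine Submodule.smul_mem _ _ ?_
    by_cases hv : v ∈ U
    · rw [Ideal.Quotient.eq_zero_iff_mem.2 (h v hv)]
      exact Submodule.zero_mem _
    · exact Submodule.subset_span ⟨v, hv, rfl⟩
  | add p q hp hq => rw [map_add]; exact Submodule.add_mem _ (hp trivial) (hq trivial)

/-- The monomial ideal spanned by the monomials with exponents in an upper set. -/
noncomputable abbrev monoIdeal (k : Type u) [Field k] (U : Set (Fin n →₀ ℕ)) (hU : IsUpperSet U) :
    Ideal (MvPolynomial (Fin n) k) := restrictSupportIdeal k U hU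

theorem mem_monoIdeal {U : Set (Fin n →₀ ℕ)} {hU : IsUpperSet U} {r : MvPolynomial (Fin n) k} :
    r ∈ monoIdeal k U hU ↔ ∀ v, coeff v r ≠ 0 → v ∈ U := by
  change (↑r.support ⊆ U) ↔ _
  simp [Set.subset_def]

theorem monomial_mem_monoIdeal {U : Set (Fin n →₀ ℕ)} {hU : IsUpperSet U} {v : Fin n →₀ ℕ} :
    monomial v (1 : k) ∈ monoIdeal k U hU ↔ v ∈ U := by
  classical
  rw [mem_monoIdeal]
  simp [coeff_monomial]

theorem isHomogeneousIdeal_iff {I : Ideal (MvPolynomial (Fin n) k)} :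
    IsHomogeneousIdeal I ↔ ∀ i, ∀ r ∈ I, homogeneousComponent i r ∈ I := by
  refine ⟨fun h i r hr => ?_, fun h i r hr => ?_⟩
  · have := h i hr
    rwa [← decomposition.decompose'_apply]
  · have := h i r hr
    rwa [← decomposition.decompose'_apply] at this

theorem isHomogeneousIdeal_monoIdeal {U : Set (Fin n →₀ ℕ)} (hU : IsUpperSet U) :
    IsHomogeneousIdeal (monoIdeal k U hU) := by
  refine isHomogeneousIdeal_iff.2 fun i r hr => mem_monoIdeal.2 fun v hv => ?_
  rw [coeff_homogeneousComponent] at hv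
  exact mem_monoIdeal.1 hr v (by aesop)

theorem isMonomialIdeal_monoIdeal {U : Set (Fin n →₀ ℕ)} (hU : IsUpperSet U) :
    IsMonomialIdeal (monoIdeal k U hU) := by
  refine ⟨U, ?_⟩
  ext r
  rw [mem_monoIdeal, mem_ideal_span_monomial_image]
  refine ⟨fun h v hv => ⟨v, h v (mem_support_iff.1 hv), le_rfl⟩, fun h v hv => ?_⟩
  obtain ⟨s, hs, hsv⟩ := h v (mem_support_iff.2 hv)
  exact hU hsv hs

theorem mem_irrelevantIdeal {r : MvPolynomial (Fin n) k} :
    r ∈ irrelevantIdeal k n ↔ coeff 0 r = 0 := by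
  have := mem_ideal_span_X_image (R := k) (x := r) (s := Set.univ)
  rw [Set.image_univ] at this
  refine this.trans ⟨fun h => ?_, fun h v hv => ?_⟩
  · by_contra h0
    obtain ⟨i, -, hi⟩ := h 0 (mem_support_iff.2 h0)
    exact hi rfl
  · by_contra! h0
    have : v = 0 := by ext i; exact h0 i trivial
    exact mem_support_iff.1 hv (this ▸ h)

theorem isMaximal_irrelevantIdeal : (irrelevantIdeal k n).IsMaximal := by
  have : irrelevantIdeal k n = RingHom.ker (constantCoeff : MvPolynomial (Fin n) k →+* k) := by
    ext r
    rw [mem_irrelevantIdeal, RingHom.mem_ker, constantCoeff_eq]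
  rw [this]
  exact RingHom.ker_isMaximal_of_surjective _ fun c => ⟨C c, by simp⟩

/-- The sets of exponents of the `m`-primary monomial ideals. -/
structure Admissible (U : Set (Fin n →₀ ℕ)) : Prop where
  isUpperSet : IsUpperSet U
  zero_notMem : 0 ∉ U
  finite_compl : Uᶜ.Finite

theorem Admissible.exists_single_mem {U : Set (Fin n →₀ ℕ)} (hU : Admissible U) (i : Fin n) :
    ∃ N, Finsupp.single i N ∈ U := by
  by_contra! h
  exact Set.infinite_of_injective_forall_mem (Finsupp.single_injective i) h hU.finite_compl

theorem Admissible.ne_top {U : Set (Fin n →₀ ℕ)} (hU : Admissible U) :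
    monoIdeal k U hU.isUpperSet ≠ ⊤ := by
  rw [Ne, Ideal.eq_top_iff_one]
  exact fun h => hU.zero_notMem (monomial_mem_monoIdeal.1 h)

theorem Admissible.isMPrimary {U : Set (Fin n →₀ ℕ)} (hU : Admissible U) :
    IsMPrimary (monoIdeal k U hU.isUpperSet) := by
  have hle : irrelevantIdeal k n ≤ (monoIdeal k U hU.isUpperSet).radical := by
    refine Ideal.span_le.2 ?_
    rintro _ ⟨i, rfl⟩
    obtain ⟨N, hN⟩ := hU.exists_single_mem i
    refine ⟨N, ?_⟩
    rw [X_pow_eq_monomial]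
    exact monomial_mem_monoIdeal.2 hN
  have hrad : (monoIdeal k U hU.isUpperSet).radical = irrelevantIdeal k n :=
    (isMaximal_irrelevantIdeal.eq_of_le (Ideal.radical_eq_top.not.2 hU.ne_top) hle).symm
  exact ⟨Ideal.isPrimary_of_isMaximal_radical (hrad ▸ isMaximal_irrelevantIdeal), hrad⟩

theorem Admissible.isCohenMacaulayRing {U : Set (Fin n →₀ ℕ)} (hU : Admissible U) :
    IsCohenMacaulayRing (MvPolynomial (Fin n) k ⧸ monoIdeal k U hU.isUpperSet) := by
  have := finite_quotient_of_finite_compl (k := k) _ U hU.finite_compl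
    (fun v hv => monomial_mem_monoIdeal (hU := hU.isUpperSet).2 hv)
  have : IsArtinianRing (MvPolynomial (Fin n) k ⧸ monoIdeal k U hU.isUpperSet) :=
    IsArtinianRing.of_finite k _
  exact isCohenMacaulayRing_of_isArtinianRing

end Monomial

/-! ### G-links from sums of coefficients -/

section Link

variable {k : Type u} [Field k] {n : ℕ}

theorem IsHomogeneousGLinkBy.symm {G I J : Ideal (MvPolynomial (Fin n) k)}
    (h : IsHomogeneousGLinkBy G I J) : IsHomogeneousGLinkBy G J I :=
  ⟨h.2, h.1, h.4, h.3, h.6, h.5, h.7, h.8, h.10, h.9⟩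

/-- The sum of the coefficients at a finite set of exponents. -/
noncomputable def coeffSum (k : Type u) [Field k] (M : Finset (Fin n →₀ ℕ)) :
    MvPolynomial (Fin n) k →ₗ[k] k := ∑ m ∈ M, lcoeff k m

theorem coeffSum_apply (M : Finset (Fin n →₀ ℕ)) (r : MvPolynomial (Fin n) k) :
    coeffSum k M r = ∑ m ∈ M, coeff m r := by
  simp [coeffSum, LinearMap.sum_apply, lcoeff]

theorem finite_quotient_annihilatorIdeal_coeffSum (M : Finset (Fin n →₀ ℕ)) :
    Module.Finite k (MvPolynomial (Fin n) k ⧸ annihilatorIdeal (coeffSum k M)) := by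
  refine finite_quotient_of_finite_compl _ {v | ∀ m ∈ M, ¬ v ≤ m} ?_ fun v hv s => ?_
  · refine (M.finite_toSet.biUnion fun m _ => Set.finite_Iic m).subset fun v hv => ?_
    simpa using hv
  · rw [coeffSum_apply]
    refine Finset.sum_eq_zero fun m hm => ?_
    rw [coeff_monomial_mul', if_neg (hv m hm)]

/-- The functional sees only degree `D`, so against a monomial of degree `e` it detects only the
component of degree `D - e`. -/
theorem isHomogeneousIdeal_annihilatorIdeal_coeffSum {M : Finset (Fin n →₀ ℕ)} {D : ℕ}
    (hM : ∀ m ∈ M, m.degree = D) :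
    IsHomogeneousIdeal (annihilatorIdeal (coeffSum k M)) := by
  refine isHomogeneousIdeal_iff.2 fun i r hr s => ?_
  induction s using MvPolynomial.induction_on' with
  | add p q hp hq => rw [mul_add, map_add, hp, hq, add_zero]
  | monomial w c =>
    have hdeg : ∀ m ∈ M, w ≤ m → (m - w).degree + w.degree = D := fun m hm hw => by
      rw [← map_add, tsub_add_cancel_of_le hw, hM m hm]
    by_cases hi : i + w.degree = D
    · rw [← hr (monomial w c), coeffSum_apply, coeffSum_apply]
      refine Finset.sum_congr rfl fun m hm => ?_
      rw [coeff_mul_monomial', coeff_mul_monomial']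
      split_ifs with hw
      · rw [coeff_homogeneousComponent, if_pos]
        have := hdeg m hm hw
        omega
      · rfl
    · rw [coeffSum_apply]
      refine Finset.sum_eq_zero fun m hm => ?_
      rw [coeff_mul_monomial']
      split_ifs with hw
      · rw [coeff_homogeneousComponent, if_neg, zero_mul]
        have := hdeg m hm hw
        omega
      · rfl

/-- The Gorenstein ideal need not be monomial. By `huniq`, pairing with `x ^ u` for `u ∈ U` isolates
at most one coefficient of `r`, so no cancellation occurs and the colon is monomial. -/
theorem colon_annihilatorIdeal_coeffSum {M : Finset (Fin n →₀ ℕ)} {U V : Set (Fin n →₀ ℕ)}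
    (hU : IsUpperSet U) (hV : IsUpperSet V) (h : ∀ v, v ∈ V ↔ ∀ u ∈ U, u + v ∉ M)
    (huniq : ∀ u ∈ U, ∀ v w, u + v ∈ M → u + w ∈ M → v = w) :
    (annihilatorIdeal (coeffSum k M)).colon (monoIdeal k U hU : Set (MvPolynomial (Fin n) k)) =
      monoIdeal k V hV := by
  ext r
  rw [Submodule.mem_colon, mem_monoIdeal]
  constructor
  · intro hr v hv
    refine (h v).2 fun u hu huv => hv ?_
    have := hr (monomial u 1) (monomial_mem_monoIdeal.2 hu) 1
    rw [mul_one, smul_eq_mul, coeffSum_apply, Finset.sum_eq_single (u + v)] at this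
    · rw [← this, coeff_mul_monomial', if_pos le_self_add, add_tsub_cancel_left, mul_one]
    · intro m hm hne
      rw [coeff_mul_monomial']
      refine if_neg fun hum => hne ?_
      obtain ⟨w, rfl⟩ := exists_add_of_le hum
      rw [huniq u hu w v hm huv]
    · exact fun h => absurd huv h
  · intro hr s hs t
    have hst : s * t ∈ monoIdeal k U hU := Ideal.mul_mem_right _ _ hs
    rw [smul_eq_mul, mul_assoc, coeffSum_apply]
    refine Finset.sum_eq_zero fun m hm => ?_
    rw [coeff_mul]
    refine Finset.sum_eq_zero fun x hx => ?_
    by_contra hne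
    have h1 := hr _ (left_ne_zero_of_mul hne)
    have h2 := mem_monoIdeal.1 hst _ (right_ne_zero_of_mul hne)
    refine (h _).1 h1 _ h2 ?_
    rwa [add_comm, Finset.HasAntidiagonal.mem_antidiagonal.1 hx]

theorem isHomogeneousGLinkBy_annihilatorIdeal_coeffSum {M : Finset (Fin n →₀ ℕ)} {D : ℕ}
    (hM : ∀ m ∈ M, m.degree = D) {U V : Set (Fin n →₀ ℕ)} (hU : Admissible U)
    (hV : Admissible V) (hUV : ∀ v, v ∈ V ↔ ∀ u ∈ U, u + v ∉ M)
    (hVU : ∀ u, u ∈ U ↔ ∀ v ∈ V, v + u ∉ M)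
    (huniqU : ∀ u ∈ U, ∀ v w, u + v ∈ M → u + w ∈ M → v = w)
    (huniqV : ∀ u ∈ V, ∀ v w, u + v ∈ M → u + w ∈ M → v = w) :
    IsHomogeneousGLinkBy (annihilatorIdeal (coeffSum k M)) (monoIdeal k U hU.isUpperSet)
      (monoIdeal k V hV.isUpperSet) := by
  have := finite_quotient_annihilatorIdeal_coeffSum (k := k) M
  exact
    { left_ne_top := hU.ne_top
      right_ne_top := hV.ne_top
      left_homogeneous := isHomogeneousIdeal_monoIdeal _
      right_homogeneous := isHomogeneousIdeal_monoIdeal _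
      left_cohenMacaulay := hU.isCohenMacaulayRing
      right_cohenMacaulay := hV.isCohenMacaulayRing
      homogeneous := isHomogeneousIdeal_annihilatorIdeal_coeffSum hM
      gorenstein := isGorensteinRing_quotient_annihilatorIdeal _
      colon_left := colon_annihilatorIdeal_coeffSum _ _ hUV huniqU
      colon_right := colon_annihilatorIdeal_coeffSum _ _ hVU huniqV }

/-- The monomial ideals of two admissible sets of exponents are homogeneously G-linked. -/
def Linked (k : Type u) [Field k] (U V : Set (Fin n →₀ ℕ)) : Prop :=
  ∃ (hU : Admissible U) (hV : Admissible V) (G : Ideal (MvPolynomial (Fin n) k)),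
    IsHomogeneousGLinkBy G (monoIdeal k U hU.isUpperSet) (monoIdeal k V hV.isUpperSet)

theorem Linked.symm {U V : Set (Fin n →₀ ℕ)} : Linked k U V → Linked k V U :=
  fun ⟨hU, hV, G, h⟩ => ⟨hV, hU, G, h.symm⟩

end Link

/-! ### Pure powers form a regular sequence -/

section CompleteIntersection

variable {k : Type u} [Field k] {n : ℕ}

theorem ofList_X_pow (a : Fin n → ℕ) (i : ℕ)
    (hU : IsUpperSet {v : Fin n →₀ ℕ | ∃ j : Fin n, (j : ℕ) < i ∧ a j ≤ v j}) :
    Ideal.ofList ((List.ofFn fun j => (X j : MvPolynomial (Fin n) k) ^ a j).take i) =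
      monoIdeal k {v | ∃ j : Fin n, (j : ℕ) < i ∧ a j ≤ v j} hU := by
  have : Ideal.ofList ((List.ofFn fun j => (X j : MvPolynomial (Fin n) k) ^ a j).take i) =
      Ideal.span ((fun s => monomial s (1 : k)) ''
        ((fun j => Finsupp.single j (a j)) '' {j : Fin n | (j : ℕ) < i})) := by
    unfold Ideal.ofList
    congr 1
    ext r
    simp only [List.mem_take_iff_getElem, List.getElem_ofFn, List.length_ofFn, Set.mem_ofPred_eq,
      Set.image_image, Set.mem_image, ← X_pow_eq_monomial]
    constructor
    · rintro ⟨j, hj, rfl⟩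
      exact ⟨⟨j, by omega⟩, by simp; omega, rfl⟩
    · rintro ⟨j, hj, rfl⟩
      exact ⟨j, by omega, rfl⟩
  rw [this]
  ext r
  rw [mem_ideal_span_monomial_image, mem_monoIdeal]
  simp [Finsupp.single_le_iff]

theorem isCompleteIntersectionIdeal_monoIdeal {a : Fin n → ℕ} (ha : ∀ i, a i ≠ 0)
    (hU : IsUpperSet {v : Fin n →₀ ℕ | ∃ j, a j ≤ v j}) :
    IsCompleteIntersectionIdeal (monoIdeal k {v : Fin n →₀ ℕ | ∃ j, a j ≤ v j} hU) := by
  have hup : ∀ i : ℕ, IsUpperSet {v : Fin n →₀ ℕ | ∃ j : Fin n, (j : ℕ) < i ∧ a j ≤ v j} :=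
    fun i v w hvw ⟨j, hj, hv⟩ => ⟨j, hj, hv.trans (hvw j)⟩
  have hall : monoIdeal k {v : Fin n →₀ ℕ | ∃ j, a j ≤ v j} hU =
      Ideal.ofList (List.ofFn fun j => (X j : MvPolynomial (Fin n) k) ^ a j) := by
    have := ofList_X_pow (k := k) a n (hup n)
    rw [List.take_of_length_le (by simp)] at this
    rw [this]
    congr 1
    ext v
    simp
  refine ⟨_, ⟨(RingTheory.Sequence.isWeaklyRegular_iff_Fin _ _).2 fun i => ?_, ?_⟩, hall⟩
  · have hi : (i : ℕ) < n := by simpa using i.2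
    rw [ofList_X_pow a i (hup i), isSMulRegular_quotient_iff_mem_of_smul_mem]
    intro r hr
    rw [smul_eq_mul, Ideal.mul_top, mem_monoIdeal] at hr ⊢
    intro v hv
    simp only [Fin.getElem_fin, List.getElem_ofFn, smul_eq_mul, X_pow_eq_monomial] at hr
    -- Multiplying by a power of `x_i` leaves the exponents of the earlier variables unchanged.
    obtain ⟨j, hj, hj'⟩ := hr (Finsupp.single ⟨i, hi⟩ (a ⟨i, hi⟩) + v) (by
      rwa [coeff_monomial_mul, one_mul])
    refine ⟨j, hj, ?_⟩
    rwa [Finsupp.add_apply, Finsupp.single_eq_of_ne (by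
      rintro rfl; exact lt_irrefl _ hj), zero_add] at hj'
  · rw [← hall, smul_eq_mul, Ideal.mul_top]
    refine fun h => ?_
    have h1 : (monomial 0 1 : MvPolynomial (Fin n) k) ∈
        monoIdeal k {v : Fin n →₀ ℕ | ∃ j, a j ≤ v j} hU := h ▸ Submodule.mem_top
    obtain ⟨j, hj⟩ := monomial_mem_monoIdeal.1 h1
    exact ha j (Nat.le_zero.1 hj)

end CompleteIntersection

/-! ### Links between box ideals, and rewriting of generators -/

section Staircase

variable {n : ℕ}

/-- The exponents of the ideal `(x₁ ^ (T₁ + 1), …, xₙ ^ (Tₙ + 1)) + (x ^ m : m ∈ K)`. -/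
def boxSum (T : Fin n →₀ ℕ) (K : Finset (Fin n →₀ ℕ)) : Set (Fin n →₀ ℕ) :=
  {v | ¬ v ≤ T ∨ ∃ m ∈ K, m ≤ v}

/-- The exponents of the ideal `(x₁ ^ (T₁ + 1), …, xₙ ^ (Tₙ + 1)) : (x ^ m : m ∈ K)`. -/
def boxColon (T : Fin n →₀ ℕ) (K : Finset (Fin n →₀ ℕ)) : Set (Fin n →₀ ℕ) :=
  {v | ∀ m ∈ K, ¬ m + v ≤ T}

/-- The exponents of the intersection of the ideals `(x₁ ^ (Pᵢ₁ + 1), …, xₙ ^ (Pᵢₙ + 1))`. -/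
def boxInter (P : Fin n → Fin n →₀ ℕ) : Set (Fin n →₀ ℕ) := {v | ∀ i, ¬ v ≤ P i}

theorem admissible_boxSum {T : Fin n →₀ ℕ} {K : Finset (Fin n →₀ ℕ)} (h0 : 0 ∉ K) :
    Admissible (boxSum T K) where
  isUpperSet v w hvw := by
    rintro (h | ⟨m, hm, h⟩)
    · exact Or.inl fun hw => h (hvw.trans hw)
    · exact Or.inr ⟨m, hm, h.trans hvw⟩
  zero_notMem := by
    rintro (h | ⟨m, hm, h⟩)
    · exact h (zero_le)
    · exact h0 (nonpos_iff_eq_zero.1 h ▸ hm)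
  finite_compl := (Set.finite_Iic T).subset fun v hv => by
    by_contra h
    exact hv (Or.inl h)

theorem admissible_boxColon {T : Fin n →₀ ℕ} {K : Finset (Fin n →₀ ℕ)} (h : ∃ m ∈ K, m ≤ T) :
    Admissible (boxColon T K) where
  isUpperSet v w hvw hv m hm hw := hv m hm ((add_le_add_right hvw m).trans hw)
  zero_notMem h0 := by
    obtain ⟨m, hm, hmT⟩ := h
    exact h0 m hm (by simpa using hmT)
  finite_compl := (Set.finite_Iic T).subset fun v hv => by
    simp only [boxColon, Set.mem_compl_iff, Set.mem_ofPred_eq, not_forall, not_not] at hv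
    obtain ⟨m, -, hm⟩ := hv
    exact le_add_self.trans hm

theorem admissible_boxInter [NeZero n] (P : Fin n → Fin n →₀ ℕ) : Admissible (boxInter P) where
  isUpperSet v w hvw hv i hw := hv i (hvw.trans hw)
  zero_notMem h0 := h0 0 (zero_le)
  finite_compl := (Set.finite_iUnion fun i => Set.finite_Iic (P i)).subset fun v hv => by
    simpa [boxInter] using hv

theorem linked_boxSum_boxColon (k : Type u) [Field k] {T : Fin n →₀ ℕ}
    {K : Finset (Fin n →₀ ℕ)} (h0 : 0 ∉ K) (h : ∃ m ∈ K, m ≤ T) :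
    Linked k (boxSum T K) (boxColon T K) := by
  have hdisj : ∀ u ∈ boxSum T K, ∀ v ∈ boxColon T K, u + v ≠ T := by
    rintro u (hu | ⟨m, hm, hu⟩) v hv rfl
    · exact hu le_self_add
    · exact hv m hm (add_le_add_left hu v)
  refine ⟨admissible_boxSum h0, admissible_boxColon h, _,
    isHomogeneousGLinkBy_annihilatorIdeal_coeffSum (M := {T}) (D := T.degree) (by simp)
      (admissible_boxSum h0) (admissible_boxColon h)
      (fun v => ⟨fun hv u hu => ?_, fun hv m hm hmT => ?_⟩)
      (fun u => ⟨fun hu v hv => ?_, fun hu => ?_⟩) ?_ ?_⟩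
  · rw [Finset.mem_singleton]
    exact hdisj u hu v hv
  · have hvT : v ≤ T := le_add_self.trans hmT
    refine hv (T - v) (Or.inr ⟨m, hm, le_tsub_of_add_le_right hmT⟩) ?_
    rw [Finset.mem_singleton, tsub_add_cancel_of_le hvT]
  · rw [Finset.mem_singleton, add_comm]
    exact hdisj u hu v hv
  · by_contra hnot
    simp only [boxSum, Set.mem_ofPred_eq, not_or, not_not, not_exists, not_and] at hnot
    refine hu (T - u) (fun m hm hmT => hnot.2 m hm fun i => ?_) ?_
    · have h1 := hmT i
      have h2 := hnot.1 i
      simp only [Finsupp.add_apply, Finsupp.tsub_apply] at h1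
      omega
    · rw [Finset.mem_singleton, tsub_add_cancel_of_le hnot.1]
  all_goals
    intro u _ v w hv hw
    rw [Finset.mem_singleton] at hv hw
    exact add_left_cancel (hv.trans hw.symm)

/-- The socle exponents are `P i + (Q i i + 1) e_i`, of common degree `D` by `hD`. An exponent of
`boxInter P` below the `i`-th one exceeds `P i i` in coordinate `i`, and one of `boxInter Q` exceeds
`Q i i`; their sum would be too large. By `hP` and `hQ` such an exponent lies below no other socle
exponent, which gives uniqueness. -/
theorem linked_boxInter_boxInter (k : Type u) [Field k] [NeZero n] {P Q : Fin n → Fin n →₀ ℕ}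
    {D : ℕ} (hPQ : ∀ i j, j ≠ i → P i j = Q i j) (hP : ∀ i j, P j i ≤ P i i)
    (hQ : ∀ i j, Q j i ≤ Q i i) (hD : ∀ i, (P i).degree + Q i i + 1 = D) :
    Linked k (boxInter P) (boxInter Q) := by
  classical
  have hP1 : ∀ i, (P i + Finsupp.single i (Q i i + 1)) i = P i i + Q i i + 1 := fun i => by
    simp [add_assoc]
  have hP2 : ∀ i j, j ≠ i → (P i + Finsupp.single i (Q i i + 1)) j = P i j := fun i j h => by
    simp [Finsupp.single_eq_of_ne h]
  have hPgt : ∀ u ∈ boxInter P, ∀ i, u ≤ P i + Finsupp.single i (Q i i + 1) → P i i < u i := by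
    intro u hu i hi
    by_contra! hlt
    refine hu i fun j => ?_
    by_cases hj : j = i
    · rwa [hj]
    · exact (hi j).trans (hP2 i j hj).le
  have hQgt : ∀ u ∈ boxInter Q, ∀ i, u ≤ P i + Finsupp.single i (Q i i + 1) → Q i i < u i := by
    intro u hu i hi
    by_contra! hlt
    refine hu i fun j => ?_
    by_cases hj : j = i
    · rwa [hj]
    · exact (hi j).trans ((hP2 i j hj).trans (hPQ i j hj)).le
  have hdisj : ∀ u ∈ boxInter P, ∀ v ∈ boxInter Q, ∀ i,
      u + v ≠ P i + Finsupp.single i (Q i i + 1) := by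
    intro u hu v hv i h
    have h1 := hPgt u hu i (h ▸ le_self_add)
    have h2 := hQgt v hv i (h ▸ le_add_self)
    have h3 := DFunLike.congr_fun h i
    rw [hP1, Finsupp.add_apply] at h3
    omega
  have hle : ∀ i, P i ≤ P i + Finsupp.single i (Q i i + 1) := fun i => le_self_add
  have hle' : ∀ i, Q i ≤ P i + Finsupp.single i (Q i i + 1) := fun i j => by
    by_cases hj : j = i
    · subst hj; rw [hP1]; omega
    · rw [hP2 i j hj, hPQ i j hj]
  refine ⟨admissible_boxInter P, admissible_boxInter Q, _,
    isHomogeneousGLinkBy_annihilatorIdeal_coeffSum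
      (M := Finset.univ.image fun i => P i + Finsupp.single i (Q i i + 1)) (D := D) ?_
      (admissible_boxInter P) (admissible_boxInter Q)
      (fun v => ⟨fun hv u hu => ?_, fun hv i hi => ?_⟩)
      (fun u => ⟨fun hu v hv => ?_, fun hu i hi => ?_⟩) ?_ ?_⟩
  · simp only [Finset.mem_image, Finset.mem_univ, true_and, forall_exists_index,
      forall_apply_eq_imp_iff, map_add, Finsupp.degree_single]
    exact fun i => hD i
  · simp only [Finset.mem_image, Finset.mem_univ, true_and, not_exists]
    exact fun i h => hdisj u hu v hv i h.symm
  -- The complement of `v` has `i`-th coordinate greater than `P i i`, hence greater than every `P j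
  -- i`, so it lies below no corner `P j`.
  · refine hv (P i + Finsupp.single i (Q i i + 1) - v) (fun j hj => ?_) ?_
    · have h1 := hj i
      have h2 := hP i j
      have h3 := hi i
      rw [Finsupp.tsub_apply, hP1] at h1
      omega
    · rw [tsub_add_cancel_of_le (hi.trans (hle' i))]
      simp
  · simp only [Finset.mem_image, Finset.mem_univ, true_and, not_exists]
    exact fun i h => hdisj u hu v hv i (by rw [h, add_comm])
  · refine hu (P i + Finsupp.single i (Q i i + 1) - u) (fun j hj => ?_) ?_
    · have h1 := hj i
      have h2 := hQ i j
      have h3 := hi i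
      rw [Finsupp.tsub_apply, hP1] at h1
      omega
    · rw [tsub_add_cancel_of_le (hi.trans (hle i))]
      simp
  · intro u hu v w hv hw
    simp only [Finset.mem_image, Finset.mem_univ, true_and] at hv hw
    obtain ⟨i, hi⟩ := hv
    obtain ⟨j, hj⟩ := hw
    have h1 := hPgt u hu i (hi ▸ le_self_add)
    by_cases hij : i = j
    · subst hij; exact add_left_cancel (hi.symm.trans hj)
    · have h2 : u i ≤ _ := (le_self_add.trans hj.ge : u ≤ _) i
      rw [hP2 j i hij] at h2
      have := hP i j
      omega
  · intro u hu v w hv hw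
    simp only [Finset.mem_image, Finset.mem_univ, true_and] at hv hw
    obtain ⟨i, hi⟩ := hv
    obtain ⟨j, hj⟩ := hw
    have h1 := hQgt u hu i (hi ▸ le_self_add)
    by_cases hij : i = j
    · subst hij; exact add_left_cancel (hi.symm.trans hj)
    · have h2 : u i ≤ _ := (le_self_add.trans hj.ge : u ≤ _) i
      rw [hP2 j i hij, hPQ j i hij] at h2
      have := hQ i j
      omega

theorem boxSum_erase_of_not_le {T m : Fin n →₀ ℕ} (K : Finset (Fin n →₀ ℕ)) (hmT : ¬ m ≤ T) :
    boxSum T K = boxSum T (K.erase m) := by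
  ext v
  refine ⟨?_, Or.imp_right fun ⟨m', hm', h⟩ => ⟨m', Finset.mem_of_mem_erase hm', h⟩⟩
  rintro (h | ⟨m', hm', h⟩)
  · exact Or.inl h
  · by_cases hmm : m' = m
    · exact Or.inl fun hv => hmT (hmm ▸ h.trans hv)
    · exact Or.inr ⟨m', Finset.mem_erase.2 ⟨hmm, hm'⟩, h⟩

theorem boxSum_erase_of_pure {T m : Fin n →₀ ℕ} {K : Finset (Fin n →₀ ℕ)} {i : Fin n}
    (hm : m ∈ K) (hmT : m ≤ T) (hi : m i ≠ 0) (hm0 : ∀ j ≠ i, m j = 0) :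
    boxSum T K = boxSum (T.update i (m i - 1)) (K.erase m) := by
  have hle : ∀ v, v ≤ T.update i (m i - 1) ↔ v ≤ T ∧ ¬ m ≤ v := by
    intro v
    have hmv : m ≤ v ↔ m i ≤ v i := by
      refine ⟨fun h => h i, fun h j => ?_⟩
      by_cases hj : j = i
      · rwa [hj]
      · rw [hm0 j hj]; exact zero_le
    rw [hmv]
    refine ⟨fun h => ?_, fun h j => ?_⟩
    · have h1 := h i
      rw [Finsupp.update_apply, if_pos rfl] at h1
      refine ⟨fun j => ?_, by omega⟩
      have h2 := h j
      by_cases hj : j = i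
      · subst hj; have := hmT j; omega
      · rwa [Finsupp.update_apply, if_neg hj] at h2
    · rw [Finsupp.update_apply]
      split_ifs with hj
      · subst hj; omega
      · exact h.1 j
  ext v
  simp only [boxSum, Set.mem_ofPred_eq, hle, Finset.mem_erase]
  constructor
  · rintro (h | ⟨m', hm', h⟩)
    · exact Or.inl fun hv => h hv.1
    · by_cases hmm : m' = m
      · exact Or.inl fun hv => hv.2 (hmm ▸ h)
      · exact Or.inr ⟨m', ⟨hmm, hm'⟩, h⟩
  · rintro (h | ⟨m', hm', h⟩)
    · by_cases hv : v ≤ T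
      · exact Or.inr ⟨m, hm, by tauto⟩
      · exact Or.inl hv
    · exact Or.inr ⟨m', hm'.2, h⟩

/-- A colon by `x_i K'` is a colon by `x_i` followed by a colon by `K'`, and the first lowers the
box by one in direction `i`. -/
theorem boxColon_eq_of_common {T : Fin n →₀ ℕ} {K : Finset (Fin n →₀ ℕ)} {i : Fin n}
    (hT : T i ≠ 0) (hK : ∀ m ∈ K, m i ≠ 0) :
    boxColon T K =
      boxColon (T - Finsupp.single i 1) (K.image fun m => m - Finsupp.single i 1) := by
  ext v
  simp only [boxColon, Set.mem_ofPred_eq, Finset.forall_mem_image]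
  refine forall₂_congr fun m hm => not_congr ?_
  rw [Finsupp.le_def, Finsupp.le_def]
  refine forall_congr' fun j => ?_
  have := hK m hm
  simp only [Finsupp.add_apply, Finsupp.tsub_apply]
  by_cases hj : i = j
  · subst hj; simp only [Finsupp.single_eq_same]; omega
  · rw [Finsupp.single_eq_of_ne' hj]; omega

theorem boxColon_image_tsub {T : Fin n →₀ ℕ} {P : Fin n → Fin n →₀ ℕ} (hP : ∀ i, P i ≤ T) :
    boxColon T (Finset.univ.image fun i => T - P i) = boxInter P := by
  ext v
  simp only [boxColon, boxInter, Set.mem_ofPred_eq, Finset.forall_mem_image, Finset.mem_univ,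
    true_implies]
  refine forall_congr' fun i => not_congr ?_
  rw [Finsupp.le_def, Finsupp.le_def]
  refine forall_congr' fun j => ?_
  have := hP i j
  simp only [Finsupp.add_apply, Finsupp.tsub_apply]
  omega

end Staircase

/-! ### Reduction of the mixed generators -/

section Glicci

variable (k : Type u) [Field k] {n : ℕ}

/-- A chain of G-links through monomial ideals joins the monomial ideal of `U` to a monomial
complete intersection. -/
def MonomiallyGlicci (U : Set (Fin n →₀ ℕ)) : Prop :=
  ∃ T : Fin n →₀ ℕ, Relation.ReflTransGen (Linked k) U (boxSum T ∅)

variable {k}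

theorem MonomiallyGlicci.of_linked {U V : Set (Fin n →₀ ℕ)} (h : Linked k U V) :
    MonomiallyGlicci k V → MonomiallyGlicci k U := fun ⟨T, hT⟩ => ⟨T, hT.head h⟩

theorem monomiallyGlicci_boxSum_empty (T : Fin n →₀ ℕ) : MonomiallyGlicci k (boxSum T ∅) :=
  ⟨T, .refl⟩

/-- Three mixed generators without common variable: a chain of links leads to at most two. -/
theorem monomiallyGlicci_of_no_common {T : Fin 3 →₀ ℕ} {m : Fin 3 → Fin 3 →₀ ℕ}
    (hmT : ∀ i, m i ≤ T) (hm : ∀ i, m i i = 0) (h0 : ∀ i, m i ≠ 0)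
    (ih : ∀ (T : Fin 3 →₀ ℕ) (K : Finset (Fin 3 →₀ ℕ)), K.card ≤ 2 → 0 ∉ K →
      MonomiallyGlicci k (boxSum T K)) :
    MonomiallyGlicci k (boxSum T (Finset.univ.image m)) := by
  let P : Fin 3 → Fin 3 →₀ ℕ := fun i => T - m i
  have hPT : ∀ i, P i ≤ T := fun i => tsub_le_self
  have hPd : ∀ i, P i i = T i := fun i => by simp [P, hm]
  have hP : ∀ i j, P j i ≤ P i i := fun i j => by rw [hPd]; exact hPT j i
  have hmP : (Finset.univ.image m) = Finset.univ.image fun i => T - P i := by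
    congr 1
    ext1 i
    exact (tsub_tsub_cancel_of_le (hmT i)).symm
  -- `b i` is the least diagonal entry allowed by the dominance condition on the new corners.
  let b : Fin 3 → ℕ := fun i => (Finset.univ.erase i).sup fun j => P j i
  have hb : ∀ i j, j ≠ i → P j i ≤ b i := fun i j h =>
    Finset.le_sup (f := fun j => P j i) (Finset.mem_erase.2 ⟨h, Finset.mem_univ j⟩)
  obtain ⟨i, -, hi⟩ := Finset.exists_max_image Finset.univ
    (fun i => (P i).degree + b i) ⟨0, Finset.mem_univ _⟩
  obtain ⟨j, hj, hij⟩ := Finset.exists_mem_eq_sup (Finset.univ.erase i)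
    (by fin_cases i <;> decide) (fun j => P j i)
  replace hj : j ≠ i := (Finset.mem_erase.1 hj).1
  change b i = P j i at hij
  -- The new diagonal makes `(P l).degree + d l` constant. Maximality of `i` ensures `b l ≤ d l`,
  -- with equality at `i`, and that the subtraction is not truncated.
  let d : Fin 3 → ℕ := fun l => (P i).degree + b i - (P l).degree
  have hd : ∀ l, (P l).degree + d l = (P i).degree + b i := fun l => by
    have := hi l (Finset.mem_univ l)
    dsimp only [d] at this ⊢
    omega
  have hbd : ∀ l, b l ≤ d l := fun l => by
    have h1 := hi l (Finset.mem_univ l)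
    have h2 := hd l
    omega
  have hdi : d i = b i := by have := hd i; omega
  let Q : Fin 3 → Fin 3 →₀ ℕ := fun l => (P l).update l (d l)
  have hQd : ∀ l, Q l l = d l := fun l => by simp [Q]
  have hQ : ∀ l l', l' ≠ l → Q l l' = P l l' := fun l l' h => by
    simp [Q, Finsupp.update_apply, h]
  have hQle : ∀ l l', Q l' l ≤ Q l l := fun l l' => by
    by_cases h : l' = l
    · rw [h]
    · rw [hQ l' l (Ne.symm h), hQd]
      exact (hb l l' h).trans (hbd l)
  let S : Fin 3 →₀ ℕ := Finsupp.equivFunOnFinite.symm d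
  have hS : ∀ l, S l = d l := fun l => rfl
  have hQS : ∀ l, Q l ≤ S := fun l l' => by rw [hS, ← hQd]; exact hQle l' l
  have h1 : Linked k (boxSum T (Finset.univ.image m)) (boxInter P) := by
    rw [← boxColon_image_tsub hPT, ← hmP]
    exact linked_boxSum_boxColon k (by simpa using h0) ⟨m 0, by simp, hmT 0⟩
  have h2 : Linked k (boxInter P) (boxInter Q) :=
    linked_boxInter_boxInter k (fun l l' h => (hQ l l' h).symm) hP hQle
      (fun l => by rw [hQd, hd])
  refine .of_linked h1 (.of_linked h2 ?_)
  by_cases hz : ∃ l, Q l = S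
  · obtain ⟨l, hl⟩ := hz
    have : boxInter Q = boxSum S ∅ := by
      ext v
      simp only [boxInter, boxSum, Set.mem_ofPred_eq, Finset.notMem_empty, false_and, exists_false,
        or_false]
      exact ⟨fun h => hl ▸ h l, fun h l' h' => h (h'.trans (hQS l'))⟩
    rw [this]
    exact monomiallyGlicci_boxSum_empty S
  · have hz' : (0 : Fin 3 →₀ ℕ) ∉ Finset.univ.image fun l => S - Q l := by
      simp only [Finset.mem_image, Finset.mem_univ, true_and, tsub_eq_zero_iff_le]
      exact fun ⟨l, hl⟩ => hz ⟨l, le_antisymm (hQS l) hl⟩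
    have h3 : Linked k (boxInter Q) (boxSum S (Finset.univ.image fun l => S - Q l)) := by
      rw [← boxColon_image_tsub hQS]
      exact (linked_boxSum_boxColon k hz' ⟨S - Q 0, by simp, tsub_le_self⟩).symm
    refine .of_linked h3 ?_
    have hmem : S - Q j ∈ Finset.univ.image fun l => S - Q l :=
      Finset.mem_image_of_mem _ (Finset.mem_univ j)
    -- The choice of `i` and `j` gives `Q j i = b i = d i`, so this generator vanishes in both
    -- coordinates and is a pure power of the third variable.
    have hzj : (S - Q j) j = 0 := by rw [Finsupp.tsub_apply, hS, hQd, tsub_self]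
    have hzi : (S - Q j) i = 0 := by
      rw [Finsupp.tsub_apply, hS, hQ j i (Ne.symm hj), hdi, hij, tsub_self]
    have hne : S - Q j ≠ 0 := fun h => hz' (h ▸ hmem)
    obtain ⟨l, hl⟩ := Finsupp.ne_iff.1 hne
    have hli : l ≠ i := fun h => hl (h ▸ hzi)
    have hlj : l ≠ j := fun h => hl (h ▸ hzj)
    have honly : ∀ l' ≠ l, (S - Q j) l' = 0 := fun l' hl' => by
      have : l' = i ∨ l' = j := by omega
      rcases this with rfl | rfl
      · exact hzi
      · exact hzj
    rw [boxSum_erase_of_pure hmem tsub_le_self hl honly]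
    refine ih _ _ ?_ fun h => hz' (Finset.mem_of_mem_erase h)
    rw [Finset.card_erase_of_mem hmem]
    have := Finset.card_image_le (s := Finset.univ) (f := fun l => S - Q l)
    simp only [Finset.card_univ, Fintype.card_fin] at this
    omega

theorem monomiallyGlicci_boxSum : ∀ c ≤ 3, ∀ (s : ℕ) (T : Fin 3 →₀ ℕ)
    (K : Finset (Fin 3 →₀ ℕ)), T.degree = s → K.card ≤ c → 0 ∉ K →
    MonomiallyGlicci k (boxSum T K) := by
  intro c
  induction c with
  | zero =>
    intro _ s T K _ hK _
    rw [Finset.card_eq_zero.1 (Nat.le_zero.1 hK)]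
    exact monomiallyGlicci_boxSum_empty T
  | succ c ihc =>
    intro hc s
    induction s using Nat.strong_induction_on with
    | _ s ihs =>
    intro T K hT hK h0
    have herase : ∀ m ∈ K, (K.erase m).card ≤ c := fun m hm => by
      rw [Finset.card_erase_of_mem hm]; omega
    have h0erase : ∀ m, 0 ∉ K.erase m := fun m h => h0 (Finset.mem_of_mem_erase h)
    by_cases hKT : ∃ m ∈ K, ¬ m ≤ T
    · obtain ⟨m, hm, hmT⟩ := hKT
      rw [boxSum_erase_of_not_le K hmT]
      exact ihc (by omega) _ _ _ rfl (herase m hm) (h0erase m)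
    push Not at hKT
    by_cases hpure : ∃ m ∈ K, ∃ i, ∀ j ≠ i, m j = 0
    · obtain ⟨m, hm, i, hi⟩ := hpure
      have hmi : m i ≠ 0 := fun h => h0 (by
        have : m = 0 := by
          ext j
          by_cases hj : j = i
          · rw [hj, h]; rfl
          · exact hi j hj
        exact this ▸ hm)
      rw [boxSum_erase_of_pure hm (hKT m hm) hmi hi]
      exact ihc (by omega) _ _ _ rfl (herase m hm) (h0erase m)
    push Not at hpure
    rcases K.eq_empty_or_nonempty with rfl | ⟨m₀, hm₀⟩
    · exact monomiallyGlicci_boxSum_empty T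
    by_cases hcommon : ∃ i, ∀ m ∈ K, m i ≠ 0
    · obtain ⟨i, hi⟩ := hcommon
      have hTi : T i ≠ 0 := fun h => hi m₀ hm₀ (Nat.le_zero.1 (h ▸ hKT m₀ hm₀ i))
      -- No member of `K` is a pure power, so dividing by `x_i` never leaves `1`.
      have h0' : (0 : Fin 3 →₀ ℕ) ∉ K.image fun m => m - Finsupp.single i 1 := by
        simp only [Finset.mem_image, not_exists, not_and]
        intro m hm h
        obtain ⟨j, hj, hmj⟩ := hpure m hm i
        have := DFunLike.congr_fun h j
        rw [Finsupp.tsub_apply, Finsupp.single_eq_of_ne hj] at this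
        exact hmj this
      have h1 := linked_boxSum_boxColon k h0 ⟨m₀, hm₀, hKT m₀ hm₀⟩
      have h2 := linked_boxSum_boxColon k (T := T - Finsupp.single i 1) h0'
        ⟨_, Finset.mem_image_of_mem _ hm₀, tsub_le_tsub_right (hKT m₀ hm₀) _⟩
      rw [← boxColon_eq_of_common hTi hi] at h2
      refine .of_linked h1 (.of_linked h2.symm ?_)
      refine ihs (T - Finsupp.single i 1).degree ?_ _ _ rfl (Finset.card_image_le.trans hK) h0'
      have hle : Finsupp.single i 1 ≤ T := by
        rw [Finsupp.single_le_iff]; omega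
      have := congrArg Finsupp.degree (tsub_add_cancel_of_le hle)
      rw [map_add, Finsupp.degree_single] at this
      omega
    · push Not at hcommon
      choose m hmK hm using hcommon
      -- A monomial free of two variables would be a pure power of the third.
      have hinj : Function.Injective m := by
        intro i j hij
        by_contra hne
        obtain ⟨l, hli, hlj⟩ :=
          (by decide : ∀ i j : Fin 3, ∃ l, l ≠ i ∧ l ≠ j) i j
        obtain ⟨l', hl', h⟩ := hpure (m i) (hmK i) l
        have : l' = i ∨ l' = j := by omega
        rcases this with rfl | rfl
        · exact h (hm l')
        · exact h (hij ▸ hm l')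
      have hcard : (Finset.univ.image m).card = 3 := by
        rw [Finset.card_image_of_injective _ hinj]; simp
      have hKeq : Finset.univ.image m = K :=
        Finset.eq_of_subset_of_card_le (by simpa [Finset.subset_iff] using hmK) (by omega)
      have hc2 : c = 2 := by
        have := Finset.card_le_card (Finset.subset_of_eq hKeq)
        omega
      subst hc2
      rw [← hKeq]
      exact monomiallyGlicci_of_no_common (fun i => hKT _ (hmK i)) hm
        (fun i h => h0 (h ▸ hmK i)) fun T K hK h0 => ihc (by omega) _ T K rfl hK h0

end Glicci

/-! ### Counting minimal generators -/

section Generators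

variable {k : Type u} [Field k] {n : ℕ}

/-- An antichain of exponents is at most as large as any generating set of the monomial ideal
it spans. -/
theorem card_le_spanFinrank_span_monomial (B : Finset (Fin n →₀ ℕ))
    (hB : IsAntichain (· ≤ ·) (B : Set (Fin n →₀ ℕ))) :
    B.card ≤ Submodule.spanFinrank
      (Ideal.span ((fun a => monomial a (1 : k)) '' (B : Set (Fin n →₀ ℕ)))) := by
  classical
  set I := Ideal.span ((fun a => monomial a (1 : k)) '' (B : Set (Fin n →₀ ℕ))) with hI
  obtain ⟨g, hg, hgI⟩ := Submodule.FG.exists_span_finset_card_eq_spanFinrank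
    (p := I) (IsNoetherian.noetherian I)
  rw [← hg]
  let L : MvPolynomial (Fin n) k →ₗ[k] (B → k) := LinearMap.pi fun b => lcoeff k b.1
  have hL : ∀ r b, L r b = coeff b.1 r := fun r b => rfl
  -- A monomial of `f` dividing `x ^ b` is a multiple of some `x ^ c` with `c ∈ B`; the antichain
  -- forces it to be `x ^ b`. So only the constant term of `r` matters: on `I`, the map `L` factors
  -- through `I / mI`.
  have hmul : ∀ r, ∀ f ∈ I, L (r * f) = coeff 0 r • L f := by
    intro r f hf
    ext b
    rw [hL, Pi.smul_apply, hL, smul_eq_mul, coeff_mul, Finset.sum_eq_single (0, b.1)]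
    · rintro ⟨x, y⟩ hxy hne
      by_contra h
      obtain ⟨c, hc, hcy⟩ := mem_ideal_span_monomial_image.1 hf y
        (mem_support_iff.2 (right_ne_zero_of_mul h))
      have hsum := Finset.HasAntidiagonal.mem_antidiagonal.1 hxy
      have hyb : y ≤ b.1 := by rw [← hsum]; exact le_add_self
      have hcb : c = b.1 := hB.eq hc b.2 (hcy.trans hyb)
      have hy : y = b.1 := le_antisymm hyb (hcb ▸ hcy)
      subst hy
      exact hne (by simpa using hsum)
    · simp [Finset.HasAntidiagonal.mem_antidiagonal]
  have hspan : ∀ f ∈ I, L f ∈ Submodule.span k (L '' (g : Set (MvPolynomial (Fin n) k))) := by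
    intro f hf
    have hgle : ∀ x ∈ g, x ∈ I := fun x hx => hgI ▸ Submodule.subset_span hx
    rw [← hgI] at hf
    induction hf using Submodule.span_induction with
    | mem x hx => exact Submodule.subset_span ⟨x, hx, rfl⟩
    | zero => rw [map_zero]; exact Submodule.zero_mem _
    | add x y _ _ hx hy => rw [map_add]; exact Submodule.add_mem _ hx hy
    | smul r x hx ih =>
      rw [smul_eq_mul, hmul r x (hgI ▸ hx)]
      exact Submodule.smul_mem _ _ ih
  have htop : Submodule.span k (L '' (g : Set (MvPolynomial (Fin n) k))) = ⊤ := by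
    rw [eq_top_iff, ← (Pi.basisFun k B).span_eq, Submodule.span_le]
    rintro _ ⟨b, rfl⟩
    have : (Pi.basisFun k B) b = L (monomial b.1 1) := by
      ext c
      rw [hL, coeff_monomial, Pi.basisFun_apply, Pi.single_apply]
      exact if_congr (by rw [Subtype.ext_iff, eq_comm]) rfl rfl
    rw [this]
    exact hspan _ (Ideal.subset_span ⟨b, b.2, rfl⟩)
  have h1 := finrank_span_finset_le_card (R := k) (g.image L)
  rw [Finset.coe_image, Set.finrank, htop, finrank_top, Module.finrank_fintype_fun_eq_card,
    Fintype.card_coe] at h1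
  exact h1.trans Finset.card_image_le

/-- The minimal exponents suffice, and they are finite in number by Dickson's lemma. -/
theorem exists_antichain_span_eq (S : Set (Fin n →₀ ℕ)) :
    ∃ B : Finset (Fin n →₀ ℕ), IsAntichain (· ≤ ·) (B : Set (Fin n →₀ ℕ)) ∧
      Ideal.span ((fun a => monomial a (1 : k)) '' S) =
        Ideal.span ((fun a => monomial a (1 : k)) '' (B : Set (Fin n →₀ ℕ))) := by
  have hanti : IsAntichain (· ≤ ·) {a | Minimal (· ∈ S) a} := setOfPred_minimal_antichain _
  have hfin : {a | Minimal (· ∈ S) a}.Finite :=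
    WellQuasiOrderedLE.finite_of_isAntichain hanti
  refine ⟨hfin.toFinset, by rwa [hfin.coe_toFinset], ?_⟩
  rw [hfin.coe_toFinset]
  ext r
  rw [mem_ideal_span_monomial_image, mem_ideal_span_monomial_image]
  refine forall₂_congr fun v _ => ⟨fun ⟨s, hs, hsv⟩ => ?_, fun ⟨s, hs, hsv⟩ => ⟨s, hs.1, hsv⟩⟩
  obtain ⟨m, hm, hmin⟩ := exists_minimal_le_of_wellFoundedLT (· ∈ S) s hs
  exact ⟨m, hmin, hm.trans hsv⟩

/-- An `m`-primary monomial ideal is given by a box and `μ(I) - n` mixed generators. -/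
theorem exists_eq_boxSum {I : Ideal (MvPolynomial (Fin n) k)} (hmon : IsMonomialIdeal I)
    (hprim : IsMPrimary I) :
    ∃ (T : Fin n →₀ ℕ) (K : Finset (Fin n →₀ ℕ)) (h0 : 0 ∉ K),
      K.card + n ≤ Submodule.spanFinrank I ∧
      I = monoIdeal k (boxSum T K) (admissible_boxSum h0).isUpperSet := by
  classical
  obtain ⟨S, rfl⟩ := hmon
  obtain ⟨B, hB, hSB⟩ := exists_antichain_span_eq (k := k) S
  rw [hSB] at hprim ⊢
  have hcard := card_le_spanFinrank_span_monomial (k := k) B hB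
  have hB0 : 0 ∉ B := fun h => hprim.1.ne_top ((Ideal.eq_top_iff_one _).2
    (Ideal.subset_span ⟨0, h, rfl⟩))
  -- Some power of `x_i` lies in the ideal, and a generator dividing it is again a power of `x_i`.
  have hpow : ∀ i : Fin n, ∃ b ∈ B, ∃ N, b = Finsupp.single i N := by
    intro i
    have hi : (X i : MvPolynomial (Fin n) k) ∈ irrelevantIdeal k n :=
      Ideal.subset_span ⟨i, rfl⟩
    rw [← hprim.2] at hi
    obtain ⟨N, hN⟩ := hi
    rw [X_pow_eq_monomial, mem_ideal_span_monomial_image] at hN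
    obtain ⟨b, hb, hbN⟩ := hN (Finsupp.single i N) (by simp [mem_support_iff])
    refine ⟨b, hb, b i, ?_⟩
    ext j
    by_cases hj : j = i
    · subst hj; simp
    · have := hbN j
      rw [Finsupp.single_eq_of_ne hj] at this ⊢
      exact Nat.le_zero.1 this
  choose p hpB N hp using hpow
  have hN0 : ∀ i, N i ≠ 0 := fun i h => hB0 (by
    have := hpB i
    rwa [hp i, h, Finsupp.single_zero] at this)
  have hinj : Function.Injective p := by
    intro i j hij
    rw [hp i, hp j] at hij
    exact ((Finsupp.single_eq_single_iff _ _ _ _).1 hij).elim And.left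
      fun h => absurd h.1 (hN0 i)
  have himage : Finset.univ.image p ⊆ B := by
    simpa [Finset.subset_iff] using hpB
  have hK : (B \ Finset.univ.image p).card + n ≤ B.card := by
    have := Finset.card_sdiff_add_card_eq_card himage
    rw [Finset.card_image_of_injective _ hinj, Finset.card_univ, Fintype.card_fin] at this
    exact this.le
  refine ⟨Finsupp.equivFunOnFinite.symm fun i => N i - 1, B \ Finset.univ.image p,
    fun h => hB0 (Finset.sdiff_subset h), hK.trans hcard, ?_⟩
  ext r
  rw [mem_ideal_span_monomial_image, mem_monoIdeal]
  simp only [mem_support_iff]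
  refine forall₂_congr fun v _ => ?_
  have hbox : ¬ v ≤ Finsupp.equivFunOnFinite.symm (fun i => N i - 1) ↔ ∃ i, p i ≤ v := by
    rw [Finsupp.le_def, not_forall]
    refine exists_congr fun i => ?_
    rw [hp i, Finsupp.single_le_iff, Finsupp.equivFunOnFinite_symm_apply_apply]
    have := hN0 i
    omega
  rw [boxSum, Set.mem_ofPred_eq, hbox]
  constructor
  · rintro ⟨b, hb, hbv⟩
    by_cases hbp : b ∈ Finset.univ.image p
    · obtain ⟨i, -, rfl⟩ := Finset.mem_image.1 hbp
      exact Or.inl ⟨i, hbv⟩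
    · exact Or.inr ⟨b, Finset.mem_sdiff.2 ⟨hb, hbp⟩, hbv⟩
  · rintro (⟨i, hi⟩ | ⟨b, hb, hbv⟩)
    · exact ⟨p i, hpB i, hi⟩
    · exact ⟨b, Finset.sdiff_subset hb, hbv⟩

end Generators

/-! ### From chains of relations to sequences of ideals -/

section Sequence

variable {k : Type u} [Field k] {n : ℕ}

theorem isCompleteIntersectionIdeal_boxSum_empty (T : Fin n →₀ ℕ)
    (hU : IsUpperSet (boxSum T ∅)) : IsCompleteIntersectionIdeal (monoIdeal k (boxSum T ∅) hU) := by
  have : boxSum T ∅ = {v : Fin n →₀ ℕ | ∃ j, T j + 1 ≤ v j} := by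
    ext v
    simp [boxSum, Finsupp.le_def]
  revert hU
  rw [this]
  exact fun hU => isCompleteIntersectionIdeal_monoIdeal (a := fun j => T j + 1) (by simp) hU

theorem MonomiallyGlicci.exists_sequence {U : Set (Fin n →₀ ℕ)} (hU : Admissible U)
    (h : MonomiallyGlicci k U) :
    ∃ (l : ℕ) (J : ℕ → Ideal (MvPolynomial (Fin n) k)),
      IsHomogeneousGlicciSequence (monoIdeal k U hU.isUpperSet) l J ∧
      ∀ i ≤ l, IsMonomialIdeal (J i) ∧ IsMPrimary (J i) := by
  obtain ⟨T, hT⟩ := h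
  induction hT using Relation.ReflTransGen.head_induction_on with
  | refl =>
    refine ⟨0, fun _ => monoIdeal k (boxSum T ∅) hU.isUpperSet, ⟨rfl, by simp,
      isHomogeneousIdeal_monoIdeal _, isCompleteIntersectionIdeal_boxSum_empty T _⟩,
      fun _ _ => ⟨isMonomialIdeal_monoIdeal _, hU.isMPrimary⟩⟩
  | head hUV _ ih =>
    obtain ⟨_, hV, G, hG⟩ := hUV
    obtain ⟨l, J, hJ, hJm⟩ := ih hV
    refine ⟨l + 1, fun i => Nat.casesOn i (monoIdeal k _ hU.isUpperSet) J,
      ⟨rfl, ?_, hJ.finish_homogeneous, hJ.finish_completeIntersection⟩, ?_⟩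
    · rintro (_ | i) hi
      · refine ⟨G, ?_⟩
        change IsHomogeneousGLinkBy G _ (J 0)
        rwa [hJ.start]
      · exact hJ.link i (by omega)
    · rintro (_ | i) hi
      · exact ⟨isMonomialIdeal_monoIdeal _, hU.isMPrimary⟩
      · exact hJm i (by omega)

end Sequence

end Glicci

/-- Every `m`-primary monomial ideal `I` of `k[x, y, z]` with minimal number of generators
`μ(I) ≤ 6` is homogeneously glicci, through a sequence of G-links `I = J 0 ~ J 1 ~ ⋯ ~ J l` in which
every second ideal `J 0, J 2, J 4, …` is an `m`-primary monomial ideal. -/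
theorem lemma3p1 {k : Type*} [Field k] (I : Ideal (MvPolynomial (Fin 3) k))
    (hmon : Glicci.IsMonomialIdeal I) (hprim : Glicci.IsMPrimary I)
    (hgen : Submodule.spanFinrank I ≤ 6) :
    ∃ (l : ℕ) (J : ℕ → Ideal (MvPolynomial (Fin 3) k)),
      Glicci.IsHomogeneousGlicciSequence I l J ∧
      ∀ i ≤ l, Even i → Glicci.IsMonomialIdeal (J i) ∧ Glicci.IsMPrimary (J i) := by
  obtain ⟨T, K, h0, hK, rfl⟩ := Glicci.exists_eq_boxSum hmon hprim
  obtain ⟨l, J, hJ, hJm⟩ := Glicci.MonomiallyGlicci.exists_sequence (Glicci.admissible_boxSum h0)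
    (Glicci.monomiallyGlicci_boxSum (k := k) 3 le_rfl _ T K rfl (by omega) h0)
  exact ⟨l, J, hJ, fun i hi _ => hJm i hi⟩
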